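/- Let $S$ be a semitopological semigroup, that is, a semigroup with a Hausdorff topology for which the maps $s\mapsto ts$ and $s\mapsto st$ are continuous for every $t\in S$. Let $C_b(S)$ be the Banach space of bounded continuous complex-valued functions on $S$ with the supremum norm, put $(\ell_s f)(t)=f(st)$, and let $WAP(S)$ be the subspace of all $f\in C_b(S)$ for which $\{\ell_s f: s\in S\}$ is relatively compact in the weak topology of $C_b(S)$. A left invariant mean (LIM) on $WAP(S)$ is a functional $m\in WAP(S)^*$ with $\|m\|=m(1)=1$ and $m(\ell_s f)=m(f)$ for all $s\in S$, $f\in WAP(S)$. Let $C$ be a nonempty closed convex subset of a complex Hilbert space $H$, and let $\{T_s: s\in S\}$ be a representation of $S$ on $C$ by nonexpansive affine self-maps; that is, each $T_s$ maps $C$ into $C$, and for all $s,t\in S$ and $x,y\in C$ we have $T_{st}x=T_s(T_tx)$, $\|T_sx-T_sy\|\le\|x-y\|$, and $T_s(ax+by)=aT_sx+bT_sy$ whenever $a,b\ge 0$, $a+b=1$. Suppose that for each $x\in C$ the map $s\mapsto T_sx$ is continuous from $S$ into $C$ with the weak topology of $H$, and that $\{T_sc: s\in S\}$ is bounded for some $c\in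 C$. If $WAP(S)$ has a left invariant mean, then $S$ has a common fixed point in $C$: there is $x\in C$ with $T_sx=x$ for all $s\in S$. -/

import Mathlib

open scoped BoundedContinuousFunction

noncomputable section

/-! ### Weakly almost periodic functions and left invariant means -/

section WAP

variable {S : Type*} [Semigroup S] [TopologicalSpace S] [SeparatelyContinuousMul S]

/-- The left translate `(ℓ_s f)(t) = f (s * t)` of a bounded continuous function. -/
def leftTranslate (s : S) (f : S →ᵇ ℂ) : S →ᵇ ℂ :=
  f.compContinuous ⟨fun t => s * t, continuous_const_mul s⟩

theorem leftTranslate_apply (s : S) (f : S →ᵇ ℂ) (t : S) :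
    leftTranslate s f t = f (s * t) := rfl

/-- The left orbit `{ℓ_s f : s ∈ S}` of `f`, as a subset of `C_b(S)` with its weak topology. -/
def leftOrbit (f : S →ᵇ ℂ) : Set (WeakSpace ℂ (S →ᵇ ℂ)) :=
  Set.range fun s : S => toWeakSpace ℂ (S →ᵇ ℂ) (leftTranslate s f)

/-- `f ∈ C_b(S)` is weakly almost periodic if its left orbit is relatively compact in the weak
topology of the Banach space `C_b(S)`. -/
def IsWeaklyAlmostPeriodic (f : S →ᵇ ℂ) : Prop :=
  IsCompact (closure (leftOrbit f))

theorem isWeaklyAlmostPeriodic_const (z : ℂ) :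
    IsWeaklyAlmostPeriodic (BoundedContinuousFunction.const S z) := by
  refine IsCompact.closure_of_subset
    (K := {toWeakSpace ℂ (S →ᵇ ℂ) (BoundedContinuousFunction.const S z)})
    isCompact_singleton ?_
  rintro _ ⟨s, rfl⟩
  rfl

theorem IsWeaklyAlmostPeriodic.add {f g : S →ᵇ ℂ} (hf : IsWeaklyAlmostPeriodic f)
    (hg : IsWeaklyAlmostPeriodic g) : IsWeaklyAlmostPeriodic (f + g) := by
  refine IsCompact.closure_of_subset ((hf.prod hg).image continuous_add) ?_
  rintro _ ⟨s, rfl⟩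
  exact ⟨(_, _), ⟨subset_closure ⟨s, rfl⟩, subset_closure ⟨s, rfl⟩⟩, rfl⟩

theorem IsWeaklyAlmostPeriodic.smul (z : ℂ) {f : S →ᵇ ℂ} (hf : IsWeaklyAlmostPeriodic f) :
    IsWeaklyAlmostPeriodic (z • f) := by
  refine IsCompact.closure_of_subset (hf.image (continuous_const_smul z)) ?_
  rintro _ ⟨s, rfl⟩
  exact ⟨_, subset_closure ⟨s, rfl⟩, rfl⟩

theorem IsWeaklyAlmostPeriodic.leftTranslate (t : S) {f : S →ᵇ ℂ}
    (hf : IsWeaklyAlmostPeriodic f) : IsWeaklyAlmostPeriodic (leftTranslate t f) := by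
  refine IsCompact.closure_of_subset hf ?_
  rintro _ ⟨s, rfl⟩
  refine subset_closure ⟨t * s, ?_⟩
  refine congrArg (toWeakSpace ℂ (S →ᵇ ℂ)) ?_
  ext u
  simp only [leftTranslate_apply, mul_assoc]

variable (S) in
/-- The space `WAP(S)` of weakly almost periodic functions, a subspace of `C_b(S)` carrying the
supremum norm. -/
def WAP : Submodule ℂ (S →ᵇ ℂ) where
  carrier := {f | IsWeaklyAlmostPeriodic f}
  add_mem' := fun hf hg => hf.add hg
  zero_mem' := isWeaklyAlmostPeriodic_const 0
  smul_mem' := fun z _ hf => hf.smul z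

namespace WAP

variable (S) in
/-- The constant function `1` as an element of `WAP(S)`. -/
def one : WAP S := ⟨BoundedContinuousFunction.const S 1, isWeaklyAlmostPeriodic_const 1⟩

/-- Left translation as a self map of `WAP(S)`. -/
def translate (s : S) (f : WAP S) : WAP S := ⟨leftTranslate s f, f.2.leftTranslate s⟩

/-- `m ∈ WAP(S)*` is a left invariant mean: `‖m‖ = m(1) = 1` and `m(ℓ_s f) = m(f)`. -/
structure IsLeftInvariantMean (m : WAP S →L[ℂ] ℂ) : Prop where
  norm_eq_one : ‖m‖ = 1
  map_one : m (one S) = 1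
  map_translate : ∀ (s : S) (f : WAP S), m (translate s f) = m f

end WAP

end WAP

/-! ### Representations of a semigroup on a subset of a normed space

The maps `T s` are written as maps of the whole space; only their restrictions to `C` matter. -/

section Representation

variable {S : Type*} [Semigroup S] {H : Type*} [NormedAddCommGroup H] [NormedSpace ℂ H]

/-- `{T_s : s ∈ S}` is a representation of `S` on `C`: each `T_s` maps `C` into `C`, and
`T_{st} x = T_s (T_t x)` for `x ∈ C`. -/
structure IsRepresentationOn (T : S → H → H) (C : Set H) : Prop where
  mapsTo : ∀ s, Set.MapsTo (T s) C C
  map_mul : ∀ s t, ∀ x ∈ C, T (s * t) x = T s (T t x)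

/-- Each `T_s` is nonexpansive on `C`. -/
def IsNonexpansiveOn (T : S → H → H) (C : Set H) : Prop :=
  ∀ s, ∀ x ∈ C, ∀ y ∈ C, ‖T s x - T s y‖ ≤ ‖x - y‖

/-- Each `T_s` respects the convex combinations of points of the (convex) set `C`. -/
def IsAffineOn (T : S → H → H) (C : Set H) : Prop :=
  ∀ s, ∀ x ∈ C, ∀ y ∈ C, ∀ a b : ℝ, 0 ≤ a → 0 ≤ b → a + b = 1 →
    T s (a • x + b • y) = a • T s x + b • T s y

/-- The set of common fixed points in `C`. -/
def commonFixedPoints (T : S → H → H) (C : Set H) : Set H :=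
  {x | x ∈ C ∧ ∀ s, T s x = x}

end Representation

end

open scoped BoundedContinuousFunction

noncomputable section

/-! Fix `c` with bounded orbit and, for a real functional `φ`, put `f_φ(s) = φ(T_s c)`. On `C` the
map `φ ∘ T_s` is affine and `‖φ‖`-Lipschitz, hence a constant plus some `ψ` with `‖ψ‖ ≤ ‖φ‖`
(`exists_strongDual_of_affine_lipschitz`). So `ℓ_s f_φ` is a constant plus `f_ψ`; by reflexivity
these translates lie in a weakly compact image of a disc times a dual ball, and `f_φ` is in `WAP S`.
Reflexivity again represents `φ ↦ Re m(f_φ)` as evaluation at a point `x`. Separation puts `x` in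
`C`, and invariance of `m` gives `φ(T_s x) = φ(x)` for every `φ`. -/

section LipschitzAffine

variable {E : Type*} [NormedAddCommGroup E] [NormedSpace ℝ E]

/-- For an affine function `g` on a convex set `C`, every vector of the linear span of the increments
`(x - c, g x - g c)` is a multiple of a single increment `(x - y, g x - g y)`. -/
theorem exists_smul_of_mem_span_increments {C : Set E} (hC : Convex ℝ C) {g : E → ℝ}
    (hg : ∀ x ∈ C, ∀ y ∈ C, ∀ a b : ℝ, 0 ≤ a → 0 ≤ b → a + b = 1 →
      g (a • x + b • y) = a * g x + b * g y) {c : E} (hc : c ∈ C) {p : E × ℝ}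
    (hp : p ∈ Submodule.span ℝ ((fun x => (x - c, g x - g c)) '' C)) :
    ∃ M : ℝ, 0 < M ∧ ∃ x ∈ C, ∃ y ∈ C, p = (M • (x - y), M * (g x - g y)) := by
  induction hp using Submodule.span_induction with
  | mem p hp =>
    obtain ⟨x, hx, rfl⟩ := hp
    exact ⟨1, one_pos, x, hx, c, hc, by simp⟩
  | zero => exact ⟨1, one_pos, c, hc, c, hc, by simp; rfl⟩
  | add p q _ _ hp hq =>
    obtain ⟨M, hM, x, hx, y, hy, rfl⟩ := hp
    obtain ⟨N, hN, z, hz, w, hw, rfl⟩ := hq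
    -- Weights `M/(M+N)` and `N/(M+N)` merge the two increments into one between convex
    -- combinations, where affinity applies.
    have hMN : M + N ≠ 0 := by positivity
    have ha : 0 ≤ M / (M + N) := by positivity
    have hb : 0 ≤ N / (M + N) := by positivity
    have hab : M / (M + N) + N / (M + N) = 1 := by field_simp
    refine ⟨M + N, by positivity, _, hC hx hz ha hb hab, _, hC hy hw ha hb hab, ?_⟩
    rw [hg x hx z hz _ _ ha hb hab, hg y hy w hw _ _ ha hb hab]
    refine Prod.ext ?_ ?_
    · simp only [Prod.mk_add_mk, smul_sub, smul_add, smul_smul, mul_div_cancel₀ _ hMN]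
      abel
    · simp only [Prod.mk_add_mk]
      field_simp
      ring
  | smul a p _ hp =>
    obtain ⟨M, hM, x, hx, y, hy, rfl⟩ := hp
    rcases lt_trichotomy a 0 with ha | rfl | ha
    · refine ⟨-a * M, mul_pos (neg_pos.2 ha) hM, y, hy, x, hx, Prod.ext ?_ ?_⟩
      · simp only [Prod.smul_mk, smul_smul, neg_mul, neg_smul, smul_sub]
        abel
      · simp only [Prod.smul_mk, smul_eq_mul]
        ring
    · exact ⟨1, one_pos, x, hx, x, hx, by simp; rfl⟩
    · refine ⟨a * M, mul_pos ha hM, x, hx, y, hy, Prod.ext ?_ ?_⟩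
      · simp only [Prod.smul_mk, smul_smul]
      · simp only [Prod.smul_mk, smul_eq_mul]
        ring

/-- An affine `K`-Lipschitz function on a convex set is, up to a constant, the restriction of a
continuous linear functional of norm at most `K`. -/
theorem exists_strongDual_of_affine_lipschitz {C : Set E} (hC : Convex ℝ C) {g : E → ℝ}
    (hg : ∀ x ∈ C, ∀ y ∈ C, ∀ a b : ℝ, 0 ≤ a → 0 ≤ b → a + b = 1 →
      g (a • x + b • y) = a * g x + b * g y) {K : ℝ} (hK : 0 ≤ K)
    (hLip : ∀ x ∈ C, ∀ y ∈ C, |g x - g y| ≤ K * ‖x - y‖) {c : E} (hc : c ∈ C) :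
    ∃ ψ : StrongDual ℝ E, ‖ψ‖ ≤ K ∧ ∀ x ∈ C, g x = g c + ψ (x - c) := by
  set G := Submodule.span ℝ ((fun x => (x - c, g x - g c)) '' C) with hG
  have hbound : ∀ p ∈ G, |p.2| ≤ K * ‖p.1‖ := by
    intro p hp
    obtain ⟨M, hM, x, hx, y, hy, rfl⟩ := exists_smul_of_mem_span_increments hC hg hc hp
    simp only [abs_mul, abs_of_pos hM, norm_smul, Real.norm_eq_abs]
    calc M * |g x - g y| ≤ M * (K * ‖x - y‖) := by gcongr; exact hLip x hx y hy
      _ = K * (M * ‖x - y‖) := by ring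
  -- The Lipschitz bound makes `G` the graph of a bounded linear map, which Hahn–Banach extends to
  -- `E`.
  have hgraph : ∀ p ∈ G, p.1 = 0 → p.2 = 0 := by
    intro p hp h
    simpa [h] using hbound p hp
  set f := G.toLinearPMap
  have hf : ∀ x : f.domain, ‖f.toFun x‖ ≤ K * ‖x‖ := fun x =>
    hbound _ (Submodule.mem_graph_toLinearPMap hgraph x)
  obtain ⟨ψ, hψ, hnorm⟩ := exists_extension_norm_eq f.domain (f.toFun.mkContinuous K hf)
  refine ⟨ψ, hnorm.trans_le (LinearMap.mkContinuous_norm_le _ hK _), fun x hx => ?_⟩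
  have hmem : (x - c, g x - g c) ∈ f.graph := by
    rw [Submodule.toLinearPMap_graph_eq _ hgraph]
    exact Submodule.subset_span ⟨x, hx, rfl⟩
  obtain ⟨z, hz, hfz⟩ := (LinearPMap.mem_graph_iff _).1 hmem
  have : ψ z = f z := hψ z
  simp only at hz hfz
  rw [← hz, this, hfz]
  ring

end LipschitzAffine

section Hilbert

variable {H : Type*} [NormedAddCommGroup H] [InnerProductSpace ℂ H] [CompleteSpace H]

/-- Real Hilbert spaces are reflexive. -/
theorem exists_forall_strongDual_eq_apply (Ξ : StrongDual ℝ (StrongDual ℝ H)) :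
    ∃ h : H, ∀ φ : StrongDual ℝ H, Ξ φ = φ h := by
  let _ : InnerProductSpace ℝ H := InnerProductSpace.rclikeToReal ℂ H
  let D := InnerProductSpace.toDual ℝ H
  let g : StrongDual ℝ H :=
    { toFun := fun x => Ξ (D x)
      map_add' := fun x y => by rw [map_add, map_add]
      map_smul' := fun a x => by rw [map_smulₛₗ, map_smul]; rfl
      cont := Ξ.continuous.comp D.continuous }
  refine ⟨D.symm g, fun φ => ?_⟩
  obtain ⟨y, rfl⟩ := D.surjective φ
  change g y = inner ℝ y (D.symm g)
  rw [real_inner_comm, InnerProductSpace.toDual_symm_apply]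

/-- A bounded operator on the dual of a Hilbert space is continuous from the weak-star topology to
the weak topology. -/
theorem continuous_toWeakSpace_comp_toStrongDual {X : Type*} [NormedAddCommGroup X]
    [NormedSpace ℂ X] (A : StrongDual ℝ H →L[ℝ] X) :
    Continuous fun ψ : WeakDual ℝ H => toWeakSpace ℂ X (A (WeakDual.toStrongDual ψ)) := by
  refine WeakBilin.continuous_of_continuous_eval _ fun l => ?_
  -- The real and imaginary parts of `l ∘ A` lie in the bidual, so they are evaluations at points,
  -- which are weak-star continuous.
  obtain ⟨h, hh⟩ := exists_forall_strongDual_eq_apply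
    (Complex.reCLM.comp ((l.restrictScalars ℝ).comp A))
  obtain ⟨k, hk⟩ := exists_forall_strongDual_eq_apply
    (Complex.imCLM.comp ((l.restrictScalars ℝ).comp A))
  have : ∀ ψ : WeakDual ℝ H, l (A (WeakDual.toStrongDual ψ)) =
      (ψ h : ℂ) + (ψ k : ℂ) * Complex.I := by
    intro ψ
    refine Complex.ext ?_ ?_
    · simpa using hh (WeakDual.toStrongDual ψ)
    · simpa using hk (WeakDual.toStrongDual ψ)
  refine Continuous.congr ?_ fun ψ => (this ψ).symm
  have h₁ := WeakDual.eval_continuous (𝕜 := ℝ) h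
  have h₂ := WeakDual.eval_continuous (𝕜 := ℝ) k
  exact (Complex.continuous_ofReal.comp h₁).add
    ((Complex.continuous_ofReal.comp h₂).mul continuous_const)

end Hilbert

section CoefficientFunction

variable {S : Type*} [TopologicalSpace S]
  {H : Type*} [NormedAddCommGroup H] [NormedSpace ℂ H]

theorem continuous_strongDual_apply {v : S → H}
    (hv : Continuous fun s => toWeakSpace ℂ H (v s)) (φ : StrongDual ℝ H) :
    Continuous fun s => φ (v s) := by
  have h : Continuous fun s => (φ.extendRCLike (𝕜 := ℂ)) (v s) :=
    (WeakBilin.eval_continuous (topDualPairing ℂ H).flip (φ.extendRCLike (𝕜 := ℂ))).comp hv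
  refine (Complex.continuous_re.comp h).congr fun s => ?_
  exact φ.re_extendRCLike_apply (𝕜 := ℂ) (v s)

/-- The coefficient operator `φ ↦ (s ↦ φ (v s))` of a bounded weakly continuous map `v`. -/
def coefficient (v : S → H) (hv : Continuous fun s => toWeakSpace ℂ H (v s)) (R : ℝ)
    (hR : 0 ≤ R) (hvR : ∀ s, ‖v s‖ ≤ R) : StrongDual ℝ H →L[ℝ] (S →ᵇ ℂ) :=
  have hle (φ : StrongDual ℝ H) (s : S) : ‖(φ (v s) : ℂ)‖ ≤ R * ‖φ‖ := by
    rw [Complex.norm_real, mul_comm]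
    exact φ.le_opNorm_of_le (hvR s)
  LinearMap.mkContinuous
    { toFun := fun φ => BoundedContinuousFunction.ofNormedAddCommGroup (fun s => (φ (v s) : ℂ))
        (Complex.continuous_ofReal.comp (continuous_strongDual_apply hv φ)) (R * ‖φ‖) (hle φ)
      map_add' := fun φ ψ => by ext s; simp
      map_smul' := fun a φ => by ext s; simp }
    R fun φ => BoundedContinuousFunction.norm_ofNormedAddCommGroup_le _ (by positivity) (hle φ)

theorem coefficient_apply (v : S → H) (hv : Continuous fun s => toWeakSpace ℂ H (v s)) (R : ℝ)
    (hR : 0 ≤ R) (hvR : ∀ s, ‖v s‖ ≤ R) (φ : StrongDual ℝ H) (s : S) :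
    coefficient v hv R hR hvR φ s = (φ (v s) : ℂ) := rfl

end CoefficientFunction

section WAP

variable {S : Type*} [Semigroup S] [TopologicalSpace S] [SeparatelyContinuousMul S]
  {H : Type*} [NormedAddCommGroup H] [InnerProductSpace ℂ H] [CompleteSpace H]

/-- If the left translates of a coefficient function are, up to bounded constants, coefficient
functions of bounded functionals, then the function is weakly almost periodic. -/
theorem isWeaklyAlmostPeriodic_coefficient (A : StrongDual ℝ H →L[ℝ] (S →ᵇ ℂ)) (f : S →ᵇ ℂ)
    (r R : ℝ)
    (h : ∀ s, ∃ z : ℂ, ‖z‖ ≤ r ∧ ∃ ψ : StrongDual ℝ H, ‖ψ‖ ≤ R ∧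
      leftTranslate s f = BoundedContinuousFunction.const S z + A ψ) :
    IsWeaklyAlmostPeriodic f := by
  have hconst : Continuous fun z : ℂ =>
      toWeakSpace ℂ (S →ᵇ ℂ) (BoundedContinuousFunction.const S z) := by
    refine (toWeakSpaceCLM ℂ (S →ᵇ ℂ)).continuous.comp ?_
    refine LipschitzWith.continuous (K := 1) (LipschitzWith.of_dist_le_mul fun z w => ?_)
    rw [NNReal.coe_one, one_mul]
    exact (BoundedContinuousFunction.dist_le dist_nonneg).2 fun _ => le_rfl
  have hsum := (hconst.comp continuous_fst).add
    ((continuous_toWeakSpace_comp_toStrongDual A).comp continuous_snd)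
  refine IsCompact.closure_of_subset (((isCompact_closedBall (0 : ℂ) r).prod
    (WeakDual.isCompact_closedBall (𝕜 := ℝ) (E := H) 0 R)).image hsum) ?_
  rintro _ ⟨s, rfl⟩
  obtain ⟨z, hz, ψ, hψ, hs⟩ := h s
  refine ⟨(z, StrongDual.toWeakDual ψ), ⟨by simpa using hz, by simpa using hψ⟩, ?_⟩
  simp only [hs]
  rfl

/-- A left invariant mean dominates the infimum of a real-valued function. -/
theorem WAP.IsLeftInvariantMean.le_re_apply {m : WAP S →L[ℂ] ℂ} (hm : IsLeftInvariantMean m)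
    (f : WAP S) (g : S → ℝ) (hfg : ∀ s, (f : S →ᵇ ℂ) s = (g s : ℂ)) {α : ℝ}
    (hα : ∀ s, α ≤ g s) : α ≤ (m f).re := by
  have hg : ∀ s, g s ≤ ‖f‖ := fun s => by
    have := (f : S →ᵇ ℂ).norm_coe_le_norm s
    rw [hfg, Complex.norm_real] at this
    exact (le_abs_self _).trans this
  -- All values of `g` lie in `[α, M]`, whence `‖M - f‖ ≤ M - α`. The maximum with `α` matters only
  -- for empty `S`.
  set M : ℝ := max ‖f‖ α
  have hnorm : ‖(M : ℂ) • one S - f‖ ≤ M - α := by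
    refine (BoundedContinuousFunction.norm_le (sub_nonneg.2 (le_max_right _ _))).2 fun s => ?_
    have : ((M : ℂ) • one S - f : WAP S).1 s = ((M - g s : ℝ) : ℂ) := by
      change (M : ℂ) * 1 - (f : S →ᵇ ℂ) s = _
      rw [hfg]
      push_cast
      ring
    change ‖((M : ℂ) • one S - f : WAP S).1 s‖ ≤ _
    rw [this, Complex.norm_real, Real.norm_eq_abs,
      abs_of_nonneg (sub_nonneg.2 ((hg s).trans (le_max_left _ _)))]
    linarith [hα s]
  have h₁ : ‖m ((M : ℂ) • one S - f)‖ ≤ M - α := by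
    have := m.le_opNorm_of_le hnorm
    rwa [hm.norm_eq_one, one_mul] at this
  have h₂ := (Complex.re_le_norm _).trans h₁
  rw [map_sub, map_smul, hm.map_one] at h₂
  simp at h₂
  linarith

end WAP

end

theorem mainTheorem4
    {S : Type*} [Semigroup S] [TopologicalSpace S] [T2Space S] [SeparatelyContinuousMul S]
    {H : Type*} [NormedAddCommGroup H] [InnerProductSpace ℂ H] [CompleteSpace H]
    (C : Set H) (hC_closed : IsClosed C) (hC_convex : Convex ℝ C)
    (T : S → H → H) (hT : IsRepresentationOn T C)
    (hT_nonexpansive : IsNonexpansiveOn T C) (hT_affine : IsAffineOn T C)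
    (hT_cont : ∀ x ∈ C, Continuous fun s : S => toWeakSpace ℂ H (T s x))
    (h_bounded : ∃ c ∈ C, Bornology.IsBounded (Set.range fun s : S => T s c))
    (h_lim : ∃ m : WAP S →L[ℂ] ℂ, WAP.IsLeftInvariantMean m) :
    (commonFixedPoints T C).Nonempty := by
  obtain ⟨c, hc, hb⟩ := h_bounded
  obtain ⟨m, hm⟩ := h_lim
  obtain ⟨R, hR, hcR⟩ : ∃ R : ℝ, 0 ≤ R ∧ ∀ s, ‖T s c‖ ≤ R := by
    obtain ⟨R, hR⟩ := hb.exists_norm_le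
    exact ⟨max R 0, le_max_right _ _, fun s => (hR _ ⟨s, rfl⟩).trans (le_max_left _ _)⟩
  let A := coefficient (fun s => T s c) (hT_cont c hc) R hR hcR
  have hdual : ∀ (φ : StrongDual ℝ H) (s : S), ∃ ψ : StrongDual ℝ H, ‖ψ‖ ≤ ‖φ‖ ∧
      ∀ x ∈ C, φ (T s x) = φ (T s c) + ψ (x - c) := fun φ s =>
    exists_strongDual_of_affine_lipschitz (g := fun x => φ (T s x)) hC_convex
      (fun x hx y hy a b ha hb hab => by simp [hT_affine s x hx y hy a b ha hb hab])
      (norm_nonneg φ)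
      (fun x hx y hy => by
        rw [← map_sub, ← Real.norm_eq_abs]
        exact φ.le_opNorm_of_le (hT_nonexpansive s x hx y hy)) hc
  have htrans : ∀ (φ ψ : StrongDual ℝ H) (s : S),
      (∀ x ∈ C, φ (T s x) = φ (T s c) + ψ (x - c)) →
      leftTranslate s (A φ) =
        BoundedContinuousFunction.const S ((φ (T s c) - ψ c : ℝ) : ℂ) + A ψ := by
    intro φ ψ s h
    ext t
    rw [leftTranslate_apply, BoundedContinuousFunction.add_apply, coefficient_apply,
      coefficient_apply, hT.map_mul s t c hc, h _ (hT.mapsTo t hc), map_sub,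
      BoundedContinuousFunction.const_apply]
    push_cast
    ring
  have hA : ∀ φ, IsWeaklyAlmostPeriodic (A φ) := fun φ => by
    refine isWeaklyAlmostPeriodic_coefficient A _ (‖φ‖ * R + ‖φ‖ * ‖c‖) ‖φ‖ fun s => ?_
    obtain ⟨ψ, hψ, h⟩ := hdual φ s
    refine ⟨_, ?_, ψ, hψ, htrans φ ψ s h⟩
    rw [Complex.norm_real]
    exact (norm_sub_le _ _).trans
      (add_le_add (φ.le_opNorm_of_le (hcR s)) (ψ.le_of_opNorm_le hψ c))
  let B : StrongDual ℝ H →L[ℝ] WAP S :=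
    A.codRestrict ((WAP S).restrictScalars ℝ) hA
  obtain ⟨x, hx⟩ := exists_forall_strongDual_eq_apply
    (Complex.reCLM.comp ((m.restrictScalars ℝ).comp B))
  replace hx : ∀ φ, (m (B φ)).re = φ x := hx
  -- A functional strictly separating `x` from `C` would exceed `u > φ x` along the orbit of `c`,
  -- and so would its mean, which is `φ x`.
  have hxC : x ∈ C := by
    by_contra hxC
    obtain ⟨φ, u, hxu, hu⟩ := geometric_hahn_banach_point_closed hC_convex hC_closed hxC
    have := hm.le_re_apply (B φ) (fun s => φ (T s c)) (fun _ => rfl) (α := u)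
      fun s => (hu _ (hT.mapsTo s hc)).le
    rw [hx] at this
    exact hxu.not_ge this
  refine ⟨x, hxC, fun s => ?_⟩
  refine (SeparatingDual.eq_iff_forall_dual_eq (R := ℝ)).2 fun φ => ?_
  obtain ⟨ψ, -, h⟩ := hdual φ s
  have hB : WAP.translate s (B φ) = ((φ (T s c) - ψ c : ℝ) : ℂ) • WAP.one S + B ψ := by
    refine Subtype.ext ((htrans φ ψ s h).trans ?_)
    ext t
    change ((φ (T s c) - ψ c : ℝ) : ℂ) + A ψ t = ((φ (T s c) - ψ c : ℝ) : ℂ) * 1 + A ψ t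
    rw [mul_one]
  -- Invariance reads `φ (T s c) - ψ c + ψ x = φ x`, and the left side is `φ (T s x)` because `x ∈
  -- C`.
  have key := congrArg Complex.re (hm.map_translate s (B φ))
  rw [hB, map_add, map_smul, hm.map_one, smul_eq_mul, mul_one, Complex.add_re, Complex.ofReal_re,
    hx, hx] at key
  rw [h x hxC, map_sub, ← key]
  ring
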